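/- For a metric space $(X,d)$ with a base point $x_0\in X$, let $\mathrm{Lip}(X)$ be the Banach space of Lipschitz functions $f:X\to\mathbb{R}$ with $f(x_0)=0$, normed by $\|f\|=\sup_{p\neq q}\frac{|f(p)-f(q)|}{d(p,q)}$, and let the Lipschitz free space $\mathcal{F}(X)$ be the norm closure in $\mathrm{Lip}(X)^*$ of the linear span of the evaluation functionals $\delta_p(f)=f(p)$, $p\in X$ (up to isometric isomorphism, it does not depend on the base point). A Banach space $V$ has the approximation property if every bounded linear operator $V\to V$ lies in the closure of the finite rank bounded operators in the topology of uniform convergence on compact subsets of $V$. An ideal of closed subsets of $X$ is a collection $\mathcal{I}$ of closed subsets of $X$ such that $\emptyset\in\mathcal{I}$; if $A\subseteq X$ is closed and $A\subseteq B\in\mathcal{I}$, then $A\in\mathcal{I}$; and if $A,B\in\mathcal{I}$, then $A\cup B\in\mathcal{I}$. The space $X$ is locally-$\mathcal{I}$ if for every $p\in X$ there is $\theta>0$ such that the closed ball $\{x\in X: d(x,p)\le\theta\}$ belongs to $\mathcal{I}$. Theorem. Let $X$ be a nonempty complete metric space and $\mathcal{I}$ an ideal of closed subsets of $X$ such that $X$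 is locally-$\mathcal{I}$. Suppose that for every $A\in\mathcal{I}$ there is a nonempty closed set $B\subseteq X$ such that $A\subseteq B$ and $\mathcal{F}(B)$ has the approximation property. Then $\mathcal{F}(X)$ has the approximation property. -/

import Mathlib

open scoped CompactConvergenceCLM

noncomputable section

/-- The real vector space of Lipschitz functions `f : X → ℝ` with `f x₀ = 0`. -/
def lipSubmodule (X : Type*) [MetricSpace X] (x₀ : X) : Submodule ℝ (X → ℝ) where
  carrier := {f | (∃ K, LipschitzWith K f) ∧ f x₀ = 0}
  add_mem' := by
    rintro f g ⟨⟨K, hK⟩, hf⟩ ⟨⟨L, hL⟩, hg⟩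
    exact ⟨⟨K + L, hK.add hL⟩, by simp [hf, hg]⟩
  zero_mem' := ⟨⟨0, LipschitzWith.const (0 : ℝ)⟩, rfl⟩
  smul_mem' := by
    rintro c f ⟨⟨K, hK⟩, hf⟩
    exact ⟨⟨‖c‖₊ * K, (lipschitzWith_smul c).comp hK⟩, by simp [hf]⟩

/-- `Lip(X)`: Lipschitz functions on the pointed metric space `(X, x₀)` vanishing at `x₀`. -/
def LipZero (X : Type*) [MetricSpace X] (x₀ : X) : Type _ := lipSubmodule X x₀

namespace LipZero

variable {X : Type*} [MetricSpace X] {x₀ : X}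

instance : AddCommGroup (LipZero X x₀) := inferInstanceAs (AddCommGroup (lipSubmodule X x₀))

instance : Module ℝ (LipZero X x₀) := inferInstanceAs (Module ℝ (lipSubmodule X x₀))

instance : CoeFun (LipZero X x₀) (fun _ => X → ℝ) := ⟨fun f => f.1⟩

/-- The Lipschitz norm `sup_{p ≠ q} |f p - f q| / d(p, q)` (equal to `0` on a one-point space). -/
instance : Norm (LipZero X x₀) :=
  ⟨fun f => ⨆ pq : {pq : X × X // pq.1 ≠ pq.2}, |f pq.1.1 - f pq.1.2| / dist pq.1.1 pq.1.2⟩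

theorem norm_def (f : LipZero X x₀) :
    ‖f‖ = ⨆ pq : {pq : X × X // pq.1 ≠ pq.2}, |f pq.1.1 - f pq.1.2| / dist pq.1.1 pq.1.2 := rfl

@[simp] theorem map_base (f : LipZero X x₀) : f x₀ = 0 := f.2.2

@[simp] theorem add_apply (f g : LipZero X x₀) (p : X) : (f + g) p = f p + g p := rfl

@[simp] theorem smul_apply (c : ℝ) (f : LipZero X x₀) (p : X) : (c • f) p = c * f p := rfl

@[simp] theorem zero_apply (p : X) : (0 : LipZero X x₀) p = 0 := rfl

theorem ext {f g : LipZero X x₀} (h : ∀ p, f p = g p) : f = g := Subtype.ext (funext h)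

theorem norm_nonneg' (f : LipZero X x₀) : 0 ≤ ‖f‖ :=
  Real.iSup_nonneg fun _ => by positivity

theorem abs_sub_le (f : LipZero X x₀) (p q : X) : |f p - f q| ≤ ‖f‖ * dist p q := by
  by_cases h : p = q
  · simp [h]
  · obtain ⟨K, hK⟩ := f.2.1
    have hbdd : BddAbove (Set.range fun pq : {pq : X × X // pq.1 ≠ pq.2} =>
        |f pq.1.1 - f pq.1.2| / dist pq.1.1 pq.1.2) := by
      refine ⟨K, ?_⟩
      rintro _ ⟨⟨⟨a, b⟩, hab⟩, rfl⟩
      have := hK.dist_le_mul a b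
      rw [Real.dist_eq] at this
      exact (div_le_iff₀ (dist_pos.2 hab)).2 this
    have := le_ciSup hbdd ⟨(p, q), h⟩
    exact (div_le_iff₀ (dist_pos.2 h)).1 this

theorem norm_le_of_abs_sub_le {f : LipZero X x₀} {C : ℝ} (hC : 0 ≤ C)
    (h : ∀ p q, |f p - f q| ≤ C * dist p q) : ‖f‖ ≤ C := by
  refine Real.iSup_le ?_ hC
  rintro ⟨⟨a, b⟩, hab⟩
  exact (div_le_iff₀ (dist_pos.2 hab)).2 (h a b)

theorem normedSpaceCore : NormedSpace.Core ℝ (LipZero X x₀) where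
  norm_nonneg := norm_nonneg'
  norm_smul c f := by
    rw [norm_def, norm_def, Real.norm_eq_abs, Real.mul_iSup_of_nonneg (abs_nonneg c)]
    refine iSup_congr fun pq => ?_
    rw [smul_apply, smul_apply, ← mul_sub, abs_mul, mul_div_assoc]
  norm_triangle f g := by
    refine norm_le_of_abs_sub_le (add_nonneg (norm_nonneg' f) (norm_nonneg' g)) fun p q => ?_
    have hf := abs_sub_le f p q
    have hg := abs_sub_le g p q
    calc |(f + g) p - (f + g) q| = |(f p - f q) + (g p - g q)| := by
          rw [add_apply, add_apply]; congr 1; ring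
      _ ≤ |f p - f q| + |g p - g q| := abs_add_le _ _
      _ ≤ (‖f‖ + ‖g‖) * dist p q := by linarith
  norm_eq_zero_iff f := by
    constructor
    · intro h
      refine ext fun p => ?_
      have := abs_sub_le f p x₀
      rw [h, map_base, zero_mul, sub_zero] at this
      simpa using abs_nonpos_iff.1 this
    · rintro rfl
      simp [norm_def]

instance : NormedAddCommGroup (LipZero X x₀) := NormedAddCommGroup.ofCore normedSpaceCore

instance : NormedSpace ℝ (LipZero X x₀) := NormedSpace.ofCore normedSpaceCore

/-- The evaluation functional `δ_p : f ↦ f p`, an element of `Lip(X)*`. -/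
def delta (x₀ : X) (p : X) : StrongDual ℝ (LipZero X x₀) :=
  LinearMap.mkContinuous
    { toFun := fun f => f p
      map_add' := fun f g => add_apply f g p
      map_smul' := fun c f => smul_apply c f p }
    (dist p x₀) (fun f => by
      have := abs_sub_le f p x₀
      rw [map_base, sub_zero] at this
      rw [mul_comm]
      exact this)

@[simp] theorem delta_apply (p : X) (f : LipZero X x₀) : delta x₀ p f = f p := rfl

end LipZero

/-- The Lipschitz free space `ℱ(X)` over `X` with base point `x₀`: the norm closure in `Lip(X)*`
of the linear span of the evaluation functionals. -/
abbrev LipschitzFree (X : Type*) [MetricSpace X] (x₀ : X) :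
    Submodule ℝ (StrongDual ℝ (LipZero X x₀)) :=
  (Submodule.span ℝ (Set.range (LipZero.delta x₀))).topologicalClosure

/-- The approximation property: every bounded operator on `V` belongs to the closure of the
finite rank operators for the topology of uniform convergence on compact sets. -/
def HasApproximationProperty (V : Type*) [NormedAddCommGroup V] [NormedSpace ℝ V] : Prop :=
  ∀ T : V →L_c[ℝ] V,
    T ∈ closure {S : V →L_c[ℝ] V | FiniteDimensional ℝ (LinearMap.range (S : V →ₗ[ℝ] V))}

/-- Ideals of closed subsets of a metric space. -/
structure IsClosedIdeal {X : Type*} [MetricSpace X] (I : Set (Set X)) : Prop where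
  isClosed : ∀ A ∈ I, IsClosed A
  empty_mem : ∅ ∈ I
  mem_of_subset : ∀ A B : Set X, IsClosed A → A ⊆ B → B ∈ I → A ∈ I
  union_mem : ∀ A ∈ I, ∀ B ∈ I, A ∪ B ∈ I

/-- `E` is locally modeled on `I`; balls are closed balls. -/
def LocallyModeledOn {X : Type*} [MetricSpace X] (I : Set (Set X)) (E : Set X) : Prop :=
  ∀ p ∈ E, ∃ θ : ℝ, 0 < θ ∧ E ∩ Metric.closedBall p θ ∈ I

end

/-! It suffices to approximate the identity on a compact set `K` of `ℱ(X)`. The heart is a compact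
reduction (`LipZero.exists_compact_reduction`): up to `ε`, `K` can be moved into the closed span of
the `δ_p` with `p` in one compact set `M ⊆ X`. Local membership puts `M` in the ideal, so `M ⊆ B`
with `ℱ(B)` having the approximation property. As `ℱ(B)` embeds isometrically in `ℱ(X)`, a finite
rank `S` is close to the identity on the moved set.

The reduction iterates `LipZero.exists_localization`. `K` is nearly in the span of the `δ_p`, `p` in
a finite set `E`. Multiplying functions by a bump equal to `1` on `E` dualizes to `δ_p ↦ w(p) δ_p`:
it fixes that span, hence barely moves `K`, and cuts supports down to a thin neighbourhood of `E`.
With widths tending to `0` and summable errors, the finite sets have totally bounded union and `M`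
is its closure.

The norms of the successive operators `T n` need not stay bounded, so the limit is only a map on
`K`. This is harmless: `S` is fixed first, then `n` is taken large and `S ∘ T n` is used. -/

open scoped CompactConvergenceCLM

/-! ### Reformulations of the approximation property -/

section ApproximationProperty

variable {V : Type*} [NormedAddCommGroup V] [NormedSpace ℝ V]

/-- Membership in the closure of a set of operators for the topology of compact convergence, in
terms of norms. -/
theorem mem_closure_compactConvergence_iff {s : Set (V →L_c[ℝ] V)} {T : V →L_c[ℝ] V} :
    T ∈ closure s ↔ ∀ K : Set V, IsCompact K → ∀ ε > 0, ∃ S ∈ s, ∀ x ∈ K, ‖S x - T x‖ < ε := by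
  have hb := (CompactConvergenceCLM.hasBasis_nhds_zero_of_basis (σ := RingHom.id ℝ) (E := V)
    (F := V) Metric.nhds_basis_ball).comap (fun S : V →L_c[ℝ] V => S - T)
  have hn : Filter.comap (fun S : V →L_c[ℝ] V => S - T) (nhds 0) = nhds T := by
    rw [← nhds_translation_sub T]
  rw [hn] at hb
  rw [mem_closure_iff_nhds_basis hb]
  constructor
  · intro h K hK ε hε
    obtain ⟨S, hS, hS'⟩ := h (K, ε) ⟨hK, hε⟩
    refine ⟨S, hS, fun x hx => ?_⟩
    simpa using hS' x hx
  · rintro h ⟨K, ε⟩ ⟨hK, hε⟩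
    obtain ⟨S, hS, hS'⟩ := h K hK ε hε
    refine ⟨S, hS, fun x hx => ?_⟩
    simpa using hS' x hx

/-- The identity alone has to be approximated: composing a finite rank approximation with `T` on the
left gives one of `T`. -/
theorem hasApproximationProperty_iff :
    HasApproximationProperty V ↔ ∀ K : Set V, IsCompact K → ∀ ε > 0, ∃ S : V →L[ℝ] V,
      FiniteDimensional ℝ (LinearMap.range (S : V →ₗ[ℝ] V)) ∧ ∀ x ∈ K, ‖S x - x‖ < ε := by
  constructor
  · intro h K hK ε hε
    exact mem_closure_compactConvergence_iff.1 (h (ContinuousLinearMap.id ℝ V)) K hK ε hε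
  · intro h T
    let T' : V →L[ℝ] V := T
    refine mem_closure_compactConvergence_iff.2 fun K hK ε hε => ?_
    have hpos : 0 < ‖T'‖ + 1 := by positivity
    obtain ⟨S, hS, hSK⟩ := h K hK (ε / (‖T'‖ + 1)) (by positivity)
    refine ⟨T'.comp S, ?_, fun x hx => ?_⟩
    · have : LinearMap.range ((T'.comp S : V →L[ℝ] V) : V →ₗ[ℝ] V)
          = (LinearMap.range (S : V →ₗ[ℝ] V)).map (T' : V →ₗ[ℝ] V) :=
        LinearMap.range_comp _ _
      change FiniteDimensional ℝ (LinearMap.range ((T'.comp S : V →L[ℝ] V) : V →ₗ[ℝ] V))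
      rw [this]
      infer_instance
    · change ‖T' (S x) - T' x‖ < ε
      rw [← map_sub]
      calc ‖T' (S x - x)‖ ≤ ‖T'‖ * ‖S x - x‖ := T'.le_opNorm _
        _ ≤ (‖T'‖ + 1) * ‖S x - x‖ := by gcongr; linarith
        _ < (‖T'‖ + 1) * (ε / (‖T'‖ + 1)) := by gcongr; exact hSK x hx
        _ = ε := by field_simp

/-- A finite rank operator on a subspace extends to the whole space with finite rank. -/
theorem exists_extension_finiteDimensional_range {E F : Type*} [NormedAddCommGroup E]
    [NormedSpace ℝ E] [NormedAddCommGroup F] [NormedSpace ℝ F] (p : Submodule ℝ E) (f : p →L[ℝ] F)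
    (hf : FiniteDimensional ℝ (LinearMap.range (f : p →ₗ[ℝ] F))) :
    ∃ g : E →L[ℝ] F, FiniteDimensional ℝ (LinearMap.range (g : E →ₗ[ℝ] F)) ∧
      ∀ x : p, g x = f x := by
  let f' : p →L[ℝ] LinearMap.range (f : p →ₗ[ℝ] F) :=
    f.codRestrict _ fun x => LinearMap.mem_range_self (f : p →ₗ[ℝ] F) x
  obtain ⟨g, hg⟩ := f'.exist_extension_of_finiteDimensional_range
  refine ⟨(LinearMap.range (f : p →ₗ[ℝ] F)).subtypeL.comp g, ?_, fun x => ?_⟩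
  · refine Submodule.finiteDimensional_of_le (S₂ := LinearMap.range (f : p →ₗ[ℝ] F)) ?_
    rintro _ ⟨x, rfl⟩
    exact (g x).2
  · exact congrArg Subtype.val (DFunLike.congr_fun hg x).symm

/-- If `V` has the approximation property, then in a space `D` containing `V ⊆ F` isometrically, the
identity on a compact subset of `V` is approximated by finite rank operators `D → F`. -/
theorem HasApproximationProperty.exists_finiteRank_approx {F D : Type*} [CompleteSpace V]
    [NormedAddCommGroup F] [NormedSpace ℝ F] [NormedAddCommGroup D] [NormedSpace ℝ D]
    (hV : HasApproximationProperty V) (i : V →ₗᵢ[ℝ] F) (j : F →ₗᵢ[ℝ] D) {K : Set D}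
    (hK : IsCompact K) (hKV : ∀ μ ∈ K, ∃ ν, j (i ν) = μ) {ε : ℝ} (hε : 0 < ε) :
    ∃ S : D →L[ℝ] F, FiniteDimensional ℝ (LinearMap.range (S : D →ₗ[ℝ] F)) ∧
      ∀ μ ∈ K, ‖j (S μ) - μ‖ < ε := by
  set k : V →ₗᵢ[ℝ] D := j.comp i with hk
  -- Completeness of `V` makes the range of the isometry `k` closed.
  have hK' : IsCompact (k ⁻¹' K) := k.isometry.isClosedEmbedding.isCompact_preimage hK
  obtain ⟨R, hR, hRK⟩ := hasApproximationProperty_iff.1 hV _ hK' ε hε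
  let f : LinearMap.range k.toLinearMap →L[ℝ] F :=
    (i.toContinuousLinearMap.comp R).comp
      k.equivRange.symm.toLinearIsometry.toContinuousLinearMap
  have hf : FiniteDimensional ℝ
      (LinearMap.range (f : LinearMap.range k.toLinearMap →ₗ[ℝ] F)) := by
    have hle : LinearMap.range (f : LinearMap.range k.toLinearMap →ₗ[ℝ] F) ≤
        (LinearMap.range (R : V →ₗ[ℝ] V)).map i.toLinearMap := by
      rintro _ ⟨y, rfl⟩
      exact ⟨_, ⟨k.equivRange.symm y, rfl⟩, rfl⟩
    exact Submodule.finiteDimensional_of_le hle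
  obtain ⟨S, hS, hSf⟩ := exists_extension_finiteDimensional_range _ f hf
  refine ⟨S, hS, fun μ hμ => ?_⟩
  obtain ⟨ν, rfl⟩ := hKV μ hμ
  have h1 : S (j (i ν)) = i (R ν) := by
    have h2 := hSf (k.equivRange ν)
    have h3 : f (k.equivRange ν) = i (R (k.equivRange.symm (k.equivRange ν))) := rfl
    rw [h3, LinearIsometryEquiv.symm_apply_apply] at h2
    exact h2
  rw [h1, ← map_sub, j.norm_map, ← map_sub, i.norm_map]
  exact hRK ν hμ

open Filter in
/-- A criterion for the approximation property: on compact sets, the identity is close to a uniform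
limit of operators whose image is approximated by finite rank operators. -/
theorem hasApproximationProperty_of_uniform_limits {D : Type*} [NormedAddCommGroup D]
    [NormedSpace ℝ D] (j : V →ₗᵢ[ℝ] D)
    (h : ∀ K : Set D, IsCompact K → K ⊆ Set.range j → ∀ ε > 0,
      ∃ (T : ℕ → D →L[ℝ] D) (T' : D → D), TendstoUniformlyOn (fun n μ => T n μ) T' atTop K ∧
        (∀ μ ∈ K, ‖T' μ - μ‖ ≤ ε) ∧
        ∃ S : D →L[ℝ] V, FiniteDimensional ℝ (LinearMap.range (S : D →ₗ[ℝ] V)) ∧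
          ∀ μ ∈ T' '' K, ‖j (S μ) - μ‖ < ε) :
    HasApproximationProperty V := by
  refine hasApproximationProperty_iff.2 fun K hK ε hε => ?_
  have hε3 : 0 < ε / 3 := by positivity
  obtain ⟨T, T', hT, hT', S, hS, hSK⟩ := h (j '' K) (hK.image j.continuous)
    (Set.image_subset_range _ _) (ε / 3) hε3
  -- `n` is chosen after `S`, with a tolerance that absorbs `‖S‖`.
  obtain ⟨n, hn⟩ := (Metric.tendstoUniformlyOn_iff.1 hT (ε / 3 / (‖S‖ + 1))
    (by positivity)).exists
  refine ⟨(S.comp (T n)).comp j.toContinuousLinearMap, ?_, fun μ hμ => ?_⟩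
  · refine Submodule.finiteDimensional_of_le (S₂ := LinearMap.range (S : D →ₗ[ℝ] V)) ?_
    rintro _ ⟨y, rfl⟩
    exact ⟨T n (j y), rfl⟩
  · have hμ' : j μ ∈ j '' K := ⟨μ, hμ, rfl⟩
    have h1 := hT' _ hμ'
    have h2 := hSK _ ⟨_, hμ', rfl⟩
    have h3 : ‖j (S (T n (j μ) - T' (j μ)))‖ ≤ ε / 3 := by
      have h4 := (hn _ hμ').le
      rw [dist_comm, dist_eq_norm] at h4
      rw [j.norm_map]
      calc ‖S (T n (j μ) - T' (j μ))‖ ≤ ‖S‖ * ‖T n (j μ) - T' (j μ)‖ := S.le_opNorm _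
        _ ≤ (‖S‖ + 1) * (ε / 3 / (‖S‖ + 1)) := by gcongr; linarith
        _ = ε / 3 := by field_simp
    have h5 : j (S (T n (j μ)) - μ) = j (S (T n (j μ) - T' (j μ)))
        + (j (S (T' (j μ))) - T' (j μ)) + (T' (j μ) - j μ) := by
      simp only [map_sub]
      abel
    change ‖S (T n (j μ)) - μ‖ < ε
    rw [← j.norm_map, h5]
    exact (norm_add₃_le).trans_lt (by linarith)

end ApproximationProperty

/-! ### Bump functions of width proportional to `1 + d(x, x₀)` -/

section Weights

variable {X : Type*} [MetricSpace X]

/-- `1 + d(x, x₀)`: the scale at which the bumps around finite sets are taken. -/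
noncomputable def radialScale (x₀ x : X) : ℝ := 1 + dist x x₀

theorem one_le_radialScale (x₀ x : X) : 1 ≤ radialScale x₀ x :=
  le_add_of_nonneg_right dist_nonneg

theorem radialScale_pos (x₀ x : X) : 0 < radialScale x₀ x :=
  one_pos.trans_le (one_le_radialScale x₀ x)

theorem abs_radialScale_sub_le (x₀ x y : X) :
    |radialScale x₀ x - radialScale x₀ y| ≤ dist x y := by
  have := abs_dist_sub_le x y x₀
  simpa [radialScale] using this

theorem radialScale_le_add (x₀ x y : X) : radialScale x₀ x ≤ radialScale x₀ y + dist x y := by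
  have := dist_triangle x y x₀
  unfold radialScale
  linarith

/-- The bump function around `E`, equal to `1` on `E` and vanishing where
`d(x, E) ≥ δ (1 + d(x, x₀))`. -/
noncomputable def radialBump (x₀ : X) (E : Set X) (δ : ℝ) (x : X) : ℝ :=
  1 - min (Metric.infDist x E) (δ * radialScale x₀ x) / (δ * radialScale x₀ x)

variable {x₀ : X} {E : Set X} {δ : ℝ}

theorem radialBump_of_mem {x : X} (hδ : 0 < δ) (hx : x ∈ E) : radialBump x₀ E δ x = 1 := by
  have := (mul_pos hδ (radialScale_pos x₀ x)).le
  simp [radialBump, Metric.infDist_zero_of_mem hx, min_eq_left this]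

theorem infDist_lt_of_radialBump_ne_zero {x : X} (hδ : 0 < δ) (hx : radialBump x₀ E δ x ≠ 0) :
    Metric.infDist x E < δ * radialScale x₀ x := by
  by_contra! h
  have := (mul_pos hδ (radialScale_pos x₀ x)).ne'
  exact hx (by simp [radialBump, min_eq_right h, this])

theorem abs_radialBump_le_one (hδ : 0 < δ) (x : X) : |radialBump x₀ E δ x| ≤ 1 := by
  have hr := mul_pos hδ (radialScale_pos x₀ x)
  have h0 : 0 ≤ min (Metric.infDist x E) (δ * radialScale x₀ x) :=
    le_min Metric.infDist_nonneg hr.le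
  have h1 : min (Metric.infDist x E) (δ * radialScale x₀ x) / (δ * radialScale x₀ x) ≤ 1 :=
    (div_le_one hr).2 (min_le_right _ _)
  have h2 := div_nonneg h0 hr.le
  unfold radialBump
  rw [abs_le]
  constructor <;> linarith

/-- The bump varies at rate of order `1 / (δ (1 + d(y, x₀)))`. The gain at infinity compensates the
linear growth of Lipschitz functions, so that multiplication by the bump is bounded on `Lip(X)`. -/
theorem radialScale_mul_abs_radialBump_sub_le (hδ : 0 < δ) (hδ1 : δ ≤ 1) (x y : X) :
    radialScale x₀ y * |radialBump x₀ E δ x - radialBump x₀ E δ y| ≤ 2 / δ * dist x y := by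
  have hx := radialScale_pos x₀ x
  have hy := radialScale_pos x₀ y
  have hxy := abs_radialScale_sub_le x₀ x y
  unfold radialBump
  set a := radialScale x₀ x
  set b := radialScale x₀ y
  set m := min (Metric.infDist x E) (δ * a) with hm
  set n := min (Metric.infDist y E) (δ * b) with hn
  have hm0 : 0 ≤ m := le_min Metric.infDist_nonneg (by positivity)
  have hma : m ≤ δ * a := min_le_right _ _
  have hmn : |m - n| ≤ dist x y := by
    have h1 := abs_min_sub_min_le_max (Metric.infDist x E) (δ * a) (Metric.infDist y E) (δ * b)
    refine h1.trans (max_le ?_ ?_)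
    · have := (Metric.lipschitz_infDist_pt E).dist_le_mul x y
      simpa [Real.dist_eq] using this
    · rw [← mul_sub, abs_mul, abs_of_pos hδ]
      calc δ * |a - b| ≤ 1 * |a - b| := by gcongr
        _ ≤ dist x y := by rwa [one_mul]
  -- Splits the change of the quotient into that of the numerator and that of the scale; since `m ≤
  -- δ a`, the factor `m / a` is at most `1`.
  have key : b * (1 - m / (δ * a) - (1 - n / (δ * b)))
      = δ⁻¹ * ((n - m) + m / a * (a - b)) := by
    field_simp
    ring
  have hma' : m / a ≤ 1 := (div_le_one hx).2 (hma.trans (by nlinarith))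
  have hma0 : 0 ≤ m / a := by positivity
  calc b * |1 - m / (δ * a) - (1 - n / (δ * b))|
      = |b * (1 - m / (δ * a) - (1 - n / (δ * b)))| := by rw [abs_mul, abs_of_pos hy]
    _ = δ⁻¹ * |(n - m) + m / a * (a - b)| := by
        rw [key, abs_mul, abs_of_pos (inv_pos.2 hδ)]
    _ ≤ δ⁻¹ * (|n - m| + |m / a * (a - b)|) := by gcongr; exact abs_add_le _ _
    _ ≤ δ⁻¹ * (dist x y + 1 * dist x y) := by
        rw [abs_mul, abs_of_nonneg hma0, abs_sub_comm n m]
        gcongr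
    _ = 2 / δ * dist x y := by ring

end Weights

/-! ### Localizing operators near finite sets -/

namespace LipZero

variable {X : Type*} [MetricSpace X] {x₀ : X}

theorem mem_lipSubmodule_of_abs_sub_le {f : X → ℝ} {C : ℝ} (hC : 0 ≤ C) (h0 : f x₀ = 0)
    (h : ∀ p q, |f p - f q| ≤ C * dist p q) : f ∈ lipSubmodule X x₀ :=
  ⟨⟨⟨C, hC⟩, LipschitzWith.of_dist_le_mul fun p q => by
    rw [Real.dist_eq]; exact h p q⟩, h0⟩

theorem abs_apply_le (f : LipZero X x₀) (p : X) : |f p| ≤ ‖f‖ * radialScale x₀ p := by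
  have h := abs_sub_le f p x₀
  rw [map_base, sub_zero] at h
  refine h.trans (mul_le_mul_of_nonneg_left ?_ (norm_nonneg' f))
  simp [radialScale]

theorem abs_radialBump_mul_sub_le {E : Set X} {δ : ℝ} (hδ : 0 < δ) (hδ1 : δ ≤ 1)
    (f : LipZero X x₀) (p q : X) :
    |radialBump x₀ E δ p * f p - radialBump x₀ E δ q * f q|
      ≤ (1 + 2 / δ) * ‖f‖ * dist p q := by
  have h1 := abs_sub_le f p q
  have h2 := abs_apply_le f q
  have h3 := radialScale_mul_abs_radialBump_sub_le (x₀ := x₀) (E := E) hδ hδ1 p q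
  have h4 := abs_radialBump_le_one (x₀ := x₀) (E := E) hδ p
  have hf := norm_nonneg' f
  set u := radialBump x₀ E δ p
  set v := radialBump x₀ E δ q
  calc |u * f p - v * f q| = |u * (f p - f q) + (u - v) * f q| := by congr 1; ring
    _ ≤ |u| * |f p - f q| + |u - v| * |f q| := by
        rw [← abs_mul, ← abs_mul]; exact abs_add_le _ _
    _ ≤ 1 * (‖f‖ * dist p q) + |u - v| * (‖f‖ * radialScale x₀ q) := by gcongr
    _ = ‖f‖ * dist p q + ‖f‖ * (radialScale x₀ q * |u - v|) := by ring
    _ ≤ ‖f‖ * dist p q + ‖f‖ * (2 / δ * dist p q) := by gcongr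
    _ = (1 + 2 / δ) * ‖f‖ * dist p q := by ring

/-- Multiplication by the bump function around `E`, as an operator on `Lip(X)`. -/
noncomputable def bumpMul (x₀ : X) (E : Set X) {δ : ℝ} (hδ : 0 < δ) (hδ1 : δ ≤ 1) :
    LipZero X x₀ →L[ℝ] LipZero X x₀ :=
  LinearMap.mkContinuous
    { toFun := fun f => (⟨fun p => radialBump x₀ E δ p * f p,
        mem_lipSubmodule_of_abs_sub_le (by have := norm_nonneg' f; positivity) (by simp)
          (abs_radialBump_mul_sub_le hδ hδ1 f)⟩ : lipSubmodule X x₀)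
      map_add' := fun f g => ext fun p => mul_add (radialBump x₀ E δ p) (f p) (g p)
      map_smul' := fun c f => ext fun p => mul_left_comm (radialBump x₀ E δ p) c (f p) }
    (1 + 2 / δ) fun f => norm_le_of_abs_sub_le (by have := norm_nonneg' f; positivity)
      (abs_radialBump_mul_sub_le hδ hδ1 f)

theorem bumpMul_apply (E : Set X) {δ : ℝ} (hδ : 0 < δ) (hδ1 : δ ≤ 1) (f : LipZero X x₀) (p : X) :
    bumpMul x₀ E hδ hδ1 f p = radialBump x₀ E δ p * f p := rfl

theorem norm_bumpMul_le (E : Set X) {δ : ℝ} (hδ : 0 < δ) (hδ1 : δ ≤ 1) :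
    ‖bumpMul x₀ E hδ hδ1‖ ≤ 1 + 2 / δ :=
  LinearMap.mkContinuous_norm_le _ (by positivity) _

/-- Precomposition with an operator, as an operator between duals. -/
noncomputable def dualOp {V W : Type*} [NormedAddCommGroup V] [NormedSpace ℝ V] [NormedAddCommGroup W]
    [NormedSpace ℝ W] (L : V →L[ℝ] W) : StrongDual ℝ W →L[ℝ] StrongDual ℝ V :=
  (ContinuousLinearMap.compL ℝ V W ℝ).flip L

@[simp] theorem dualOp_apply {V W : Type*} [NormedAddCommGroup V] [NormedSpace ℝ V]
    [NormedAddCommGroup W] [NormedSpace ℝ W] (L : V →L[ℝ] W) (φ : StrongDual ℝ W) (x : V) :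
    dualOp L φ x = φ (L x) := rfl

theorem norm_dualOp_apply_le {V W : Type*} [NormedAddCommGroup V] [NormedSpace ℝ V]
    [NormedAddCommGroup W] [NormedSpace ℝ W] (L : V →L[ℝ] W) (φ : StrongDual ℝ W) :
    ‖dualOp L φ‖ ≤ ‖L‖ * ‖φ‖ := by
  rw [mul_comm]
  exact φ.opNorm_comp_le L

theorem dualOp_bumpMul_delta (E : Set X) {δ : ℝ} (hδ : 0 < δ) (hδ1 : δ ≤ 1) (p : X) :
    dualOp (bumpMul x₀ E hδ hδ1) (delta x₀ p) = radialBump x₀ E δ p • delta x₀ p :=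
  ContinuousLinearMap.ext fun f => bumpMul_apply E hδ hδ1 f p

/-- The closed span of the evaluation functionals at points of `A`. -/
noncomputable def freeOn (x₀ : X) (A : Set X) : Submodule ℝ (StrongDual ℝ (LipZero X x₀)) :=
  (Submodule.span ℝ (delta x₀ '' A)).topologicalClosure

theorem span_delta_le_freeOn (A : Set X) : Submodule.span ℝ (delta x₀ '' A) ≤ freeOn x₀ A :=
  Submodule.le_topologicalClosure _

theorem delta_mem_freeOn {A : Set X} {p : X} (hp : p ∈ A) : delta x₀ p ∈ freeOn x₀ A :=
  span_delta_le_freeOn A (Submodule.subset_span ⟨p, hp, rfl⟩)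

theorem isClosed_freeOn (A : Set X) : IsClosed (freeOn x₀ A : Set (StrongDual ℝ (LipZero X x₀))) :=
  Submodule.isClosed_topologicalClosure _

theorem freeOn_le {A : Set X} {S : Submodule ℝ (StrongDual ℝ (LipZero X x₀))}
    (hS : IsClosed (S : Set (StrongDual ℝ (LipZero X x₀)))) (h : ∀ p ∈ A, delta x₀ p ∈ S) :
    freeOn x₀ A ≤ S := by
  refine Submodule.topologicalClosure_minimal _ (Submodule.span_le.2 ?_) hS
  rintro _ ⟨p, hp, rfl⟩
  exact h p hp

theorem freeOn_mono {A B : Set X} (h : A ⊆ B) : freeOn x₀ A ≤ freeOn x₀ B :=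
  freeOn_le (isClosed_freeOn B) fun _ hp => delta_mem_freeOn (h hp)

theorem freeOn_univ : freeOn x₀ (Set.univ : Set X) = LipschitzFree X x₀ := by
  rw [freeOn, Set.image_univ]

theorem map_mem_of_mem_freeOn {F : Type*} [NormedAddCommGroup F] [NormedSpace ℝ F]
    {A : Set X} {S : Submodule ℝ F} (hS : IsClosed (S : Set F))
    (T : StrongDual ℝ (LipZero X x₀) →L[ℝ] F) (h : ∀ p ∈ A, T (delta x₀ p) ∈ S)
    {μ : StrongDual ℝ (LipZero X x₀)} (hμ : μ ∈ freeOn x₀ A) : T μ ∈ S := by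
  have : freeOn x₀ A ≤ S.comap (T : StrongDual ℝ (LipZero X x₀) →ₗ[ℝ] F) :=
    freeOn_le (hS.preimage T.continuous) h
  exact this hμ

/-- A compact subset of the closed span of `δ_p`, `p ∈ A`, is within `η` of the span of finitely
many of them. -/
theorem exists_finite_approx {A : Set X} (hx₀ : x₀ ∈ A) {K : Set (StrongDual ℝ (LipZero X x₀))}
    (hK : IsCompact K) (hKA : K ⊆ freeOn x₀ A) {η : ℝ} (hη : 0 < η) :
    ∃ E : Set X, E.Finite ∧ x₀ ∈ E ∧ E ⊆ A ∧
      ∀ μ ∈ K, ∃ ν ∈ Submodule.span ℝ (delta x₀ '' E), ‖μ - ν‖ < η := by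
  classical
  have hfin : ∀ ν ∈ Submodule.span ℝ (delta x₀ '' A), ∃ E : Set X, E.Finite ∧ E ⊆ A ∧
      ν ∈ Submodule.span ℝ (delta x₀ '' E) := by
    intro ν hν
    obtain ⟨t, ht, hν'⟩ := Submodule.mem_span_finite_of_mem_span hν
    obtain ⟨E, hEA, rfl⟩ := Finset.subset_set_image_iff.1 ht
    exact ⟨E, E.finite_toSet, hEA, by simpa using hν'⟩
  obtain ⟨t, htK, ht, hcov⟩ := hK.finite_cover_balls (half_pos hη)
  have hpt : ∀ μ ∈ t, ∃ E : Set X, E.Finite ∧ E ⊆ A ∧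
      ∃ ν ∈ Submodule.span ℝ (delta x₀ '' E), ‖μ - ν‖ < η / 2 := by
    intro μ hμ
    have hμ' : μ ∈ closure (Submodule.span ℝ (delta x₀ '' A) : Set _) := hKA (htK hμ)
    obtain ⟨ν, hν, hd⟩ := Metric.mem_closure_iff.1 hμ' (η / 2) (half_pos hη)
    obtain ⟨E, hE, hEA, hνE⟩ := hfin ν hν
    exact ⟨E, hE, hEA, ν, hνE, by rwa [← dist_eq_norm]⟩
  choose! E hE hEA ν hν hd using hpt
  -- Including `x₀` keeps `E` nonempty, so that `infDist` to it is meaningful, and keeps `x₀` in the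
  -- next support.
  refine ⟨insert x₀ (⋃ μ ∈ t, E μ), (ht.biUnion hE).insert x₀, Set.mem_insert _ _,
    Set.insert_subset hx₀ (Set.iUnion₂_subset hEA), fun μ hμ => ?_⟩
  obtain ⟨μ', hμ', hball⟩ := Set.mem_iUnion₂.1 (hcov hμ)
  refine ⟨ν μ', Submodule.span_mono (Set.image_mono ?_) (hν μ' hμ'), ?_⟩
  · exact (Set.subset_biUnion_of_mem (u := E) hμ').trans (Set.subset_insert _ _)
  · have h1 : ‖μ - μ'‖ < η / 2 := by rw [← dist_eq_norm]; exact hball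
    have h2 := hd μ' hμ'
    calc ‖μ - ν μ'‖ = ‖(μ - μ') + (μ' - ν μ')‖ := by rw [sub_add_sub_cancel]
      _ ≤ ‖μ - μ'‖ + ‖μ' - ν μ'‖ := norm_add_le _ _
      _ < η := by linarith

/-- The basic localization step: an operator with values in the closed span of `δ_p`, `p ∈ A`, is
perturbed, little on `K`, into one with values supported near a finite set. -/
theorem exists_localization {A : Set X} (hx₀ : x₀ ∈ A) {K : Set (StrongDual ℝ (LipZero X x₀))}
    (hK : IsCompact K) (T : StrongDual ℝ (LipZero X x₀) →L[ℝ] StrongDual ℝ (LipZero X x₀))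
    (hT : ∀ μ ∈ K, T μ ∈ freeOn x₀ A) {δ η : ℝ} (hδ : 0 < δ) (hδ1 : δ ≤ 1) (hη : 0 < η) :
    ∃ (E : Set X) (A' : Set X)
      (T' : StrongDual ℝ (LipZero X x₀) →L[ℝ] StrongDual ℝ (LipZero X x₀)),
      E.Finite ∧ x₀ ∈ E ∧ E ⊆ A ∧ A' ⊆ A ∧ x₀ ∈ A' ∧
      (∀ x ∈ A', Metric.infDist x E < δ * radialScale x₀ x) ∧
      (∀ μ ∈ K, T' μ ∈ freeOn x₀ A') ∧ (∀ μ ∈ K, ‖T' μ - T μ‖ ≤ η) ∧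
      ∀ μ ∈ K, ∃ ν ∈ Submodule.span ℝ (delta x₀ '' E), ‖T μ - ν‖ < η := by
  set C : ℝ := 1 + 2 / δ with hC
  have hC1 : 1 ≤ C := by have : 0 < 2 / δ := by positivity
                         linarith
  -- Since `S` fixes `ν` and has norm at most `C`, it moves `T μ` by at most `(C + 1) ‖T μ - ν‖`.
  have hη' : 0 < η / (C + 1) := by positivity
  have hle : η / (C + 1) ≤ η := div_le_self hη.le (by linarith)
  obtain ⟨E, hE, hxE, hEA, happ⟩ := exists_finite_approx hx₀ (hK.image T.continuous)
    (Set.image_subset_iff.2 hT) hη'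
  set S := dualOp (bumpMul x₀ E hδ hδ1) with hS
  refine ⟨E, {x ∈ A | radialBump x₀ E δ x ≠ 0}, S.comp T, hE, hxE, hEA, Set.sep_subset _ _,
    ⟨hx₀, by rw [radialBump_of_mem hδ hxE]; exact one_ne_zero⟩,
    fun x hx => infDist_lt_of_radialBump_ne_zero hδ hx.2, fun μ hμ => ?_, fun μ hμ => ?_,
    fun μ hμ => ?_⟩
  · refine map_mem_of_mem_freeOn (isClosed_freeOn _) S (fun p hp => ?_) (hT μ hμ)
    rw [hS, dualOp_bumpMul_delta]
    by_cases h : radialBump x₀ E δ p = 0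
    · rw [h, zero_smul]
      exact Submodule.zero_mem _
    · exact Submodule.smul_mem _ _ (delta_mem_freeOn ⟨hp, h⟩)
  · obtain ⟨ν, hν, hd⟩ := happ _ ⟨μ, hμ, rfl⟩
    have hfix : S ν = ν := by
      have : Submodule.span ℝ (delta x₀ '' E) ≤ LinearMap.eqLocus
          (S : StrongDual ℝ (LipZero X x₀) →ₗ[ℝ] StrongDual ℝ (LipZero X x₀)) LinearMap.id := by
        rw [Submodule.span_le]
        rintro _ ⟨p, hp, rfl⟩
        change S (delta x₀ p) = delta x₀ p
        rw [hS, dualOp_bumpMul_delta, radialBump_of_mem hδ hp, one_smul]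
      exact this hν
    have hb : ‖S (T μ - ν)‖ ≤ C * ‖T μ - ν‖ :=
      (norm_dualOp_apply_le _ _).trans
        (mul_le_mul_of_nonneg_right (norm_bumpMul_le E hδ hδ1) (norm_nonneg _))
    calc ‖S (T μ) - T μ‖ = ‖S (T μ - ν) - (T μ - ν)‖ := by
          rw [map_sub, hfix, sub_sub_sub_cancel_right]
      _ ≤ ‖S (T μ - ν)‖ + ‖T μ - ν‖ := norm_sub_le _ _
      _ ≤ (C + 1) * ‖T μ - ν‖ := by linarith
      _ ≤ (C + 1) * (η / (C + 1)) := by gcongr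
      _ = η := by field_simp
  · obtain ⟨ν, hν, hd⟩ := happ _ ⟨μ, hμ, rfl⟩
    exact ⟨ν, hν, hd.trans_le hle⟩

end LipZero

open Filter Topology in
/-- A family of finite sets, each contained in small neighbourhoods of the previous ones, has a
totally bounded union. -/
theorem totallyBounded_iUnion_of_nested {X : Type*} [MetricSpace X] (x₀ : X) {E A : ℕ → Set X}
    {δ : ℕ → ℝ} (hE : ∀ n, (E n).Finite) (hEne : ∀ n, (E n).Nonempty) (hδ0 : ∀ n, 0 < δ n)
    (hδ1 : ∀ n, δ n ≤ 1 / 2) (hδ : Tendsto δ atTop (𝓝 0)) (hEA : ∀ n, E n ⊆ A n)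
    (hA : Antitone A)
    (hAE : ∀ n, ∀ x ∈ A (n + 1), Metric.infDist x (E n) < δ n * radialScale x₀ x) :
    TotallyBounded (⋃ n, E n) := by
  have hnear : ∀ n, ∀ x ∈ A (n + 1), ∃ e ∈ E n, dist x e < δ n * radialScale x₀ x :=
    fun n x hx => (Metric.infDist_lt_iff (hEne n)).1 (hAE n x hx)
  -- The bound `δ 0 ≤ 1/2` allows absorption: `r(x) ≤ r(e) + r(x)/2` gives `r(x) ≤ 2 r(e)`, and `e`
  -- ranges over a finite set.
  obtain ⟨R, hR⟩ : ∃ R, ∀ x ∈ A 1, radialScale x₀ x ≤ R := by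
    obtain ⟨R, hR⟩ := ((hE 0).image (radialScale x₀)).bddAbove
    refine ⟨2 * R, fun x hx => ?_⟩
    obtain ⟨e, he, hd⟩ := hnear 0 x hx
    have h1 := radialScale_le_add x₀ x e
    have h2 : radialScale x₀ e ≤ R := hR ⟨e, he, rfl⟩
    have h3 := radialScale_pos x₀ x
    have h4 : δ 0 * radialScale x₀ x ≤ 1 / 2 * radialScale x₀ x := by gcongr; exact hδ1 0
    linarith
  rw [Metric.totallyBounded_iff]
  intro ε hε
  have hlim : Tendsto (fun n => δ n * R) atTop (𝓝 0) := by simpa using hδ.mul_const R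
  obtain ⟨n, hn⟩ := (hlim.eventually (gt_mem_nhds hε)).exists
  -- For `m > n` the points of `E m` lie in `A (n + 1)`, hence within `δ n * R < ε` of `E n`.
  refine ⟨⋃ m ≤ n, E m, (Set.finite_le_nat n).biUnion fun m _ => hE m, ?_⟩
  refine Set.iUnion_subset fun m x hx => ?_
  rcases le_or_gt m n with hmn | hmn
  · exact Set.mem_biUnion (Set.mem_biUnion (x := m) hmn hx) (Metric.mem_ball_self hε)
  · have hx' := hEA m hx
    obtain ⟨e, he, hd⟩ := hnear n x (hA hmn hx')
    refine Set.mem_biUnion (Set.mem_biUnion (x := n) (le_refl n) he) ?_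
    have h1 := hR x (hA (by omega : 1 ≤ m) hx')
    calc dist x e < δ n * radialScale x₀ x := hd
      _ ≤ δ n * R := by have := hδ0 n; gcongr
      _ < ε := hn

/-! ### Iterated localization and its limit -/

namespace LipZero

variable {X : Type*} [MetricSpace X] {x₀ : X}

open Filter Topology

/-- An operator and a set `A` such that the operator maps `K` into the closed span of `δ_p`, `p ∈ A`. -/
abbrev LocalizationStage (x₀ : X) (K : Set (StrongDual ℝ (LipZero X x₀))) : Type _ :=
  {s : (StrongDual ℝ (LipZero X x₀) →L[ℝ] StrongDual ℝ (LipZero X x₀)) × Set X //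
    x₀ ∈ s.2 ∧ ∀ μ ∈ K, s.1 μ ∈ freeOn x₀ s.2}

/-- Successive localizations of the identity around finite sets. -/
theorem exists_localization_seq {K : Set (StrongDual ℝ (LipZero X x₀))} (hK : IsCompact K)
    (hKX : K ⊆ LipschitzFree X x₀) {δ η : ℕ → ℝ} (hδ : ∀ n, 0 < δ n) (hδ1 : ∀ n, δ n ≤ 1)
    (hη : ∀ n, 0 < η n) :
    ∃ (E A : ℕ → Set X)
      (T : ℕ → StrongDual ℝ (LipZero X x₀) →L[ℝ] StrongDual ℝ (LipZero X x₀)),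
      T 0 = ContinuousLinearMap.id ℝ _ ∧ (∀ n, (E n).Finite) ∧ (∀ n, x₀ ∈ E n) ∧
      (∀ n, E n ⊆ A n) ∧ Antitone A ∧
      (∀ n, ∀ x ∈ A (n + 1), Metric.infDist x (E n) < δ n * radialScale x₀ x) ∧
      (∀ n, ∀ μ ∈ K, ‖T (n + 1) μ - T n μ‖ ≤ η n) ∧
      ∀ n, ∀ μ ∈ K, ∃ ν ∈ Submodule.span ℝ (delta x₀ '' E n), ‖T n μ - ν‖ < η n := by
  have step : ∀ (n : ℕ) (s : LocalizationStage x₀ K), ∃ (E : Set X) (s' : LocalizationStage x₀ K),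
      E.Finite ∧ x₀ ∈ E ∧ E ⊆ s.1.2 ∧ s'.1.2 ⊆ s.1.2 ∧
      (∀ x ∈ s'.1.2, Metric.infDist x E < δ n * radialScale x₀ x) ∧
      (∀ μ ∈ K, ‖s'.1.1 μ - s.1.1 μ‖ ≤ η n) ∧
      ∀ μ ∈ K, ∃ ν ∈ Submodule.span ℝ (delta x₀ '' E), ‖s.1.1 μ - ν‖ < η n := by
    rintro n ⟨⟨T, A⟩, hxA, hT⟩
    obtain ⟨E, A', T', h1, h2, h3, h4, h5, h6, h7, h8, h9⟩ :=
      exists_localization hxA hK T hT (hδ n) (hδ1 n) (hη n)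
    exact ⟨E, ⟨(T', A'), h5, h7⟩, h1, h2, h3, h4, h6, h8, h9⟩
  choose E next h1 h2 h3 h4 h5 h6 h7 using step
  let s₀ : LocalizationStage x₀ K := ⟨(ContinuousLinearMap.id ℝ _, Set.univ), Set.mem_univ _,
    fun μ hμ => by rw [freeOn_univ]; exact hKX hμ⟩
  let s : ℕ → LocalizationStage x₀ K := fun n => Nat.rec s₀ next n
  exact ⟨fun n => E n (s n), fun n => (s n).1.2, fun n => (s n).1.1, rfl, fun n => h1 n (s n),
    fun n => h2 n (s n), fun n => h3 n (s n), antitone_nat_of_succ_le fun n => h4 n (s n),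
    fun n => h5 n (s n), fun n => h6 n (s n), fun n => h7 n (s n)⟩

/-- **Compact reduction**: a compact subset of `ℱ(X)` is uniformly close to its image under a
uniform limit of bounded operators, with values in the closed span of `δ_p`, `p` in a compact
set. -/
theorem exists_compact_reduction [CompleteSpace X] {K : Set (StrongDual ℝ (LipZero X x₀))}
    (hK : IsCompact K) (hKX : K ⊆ LipschitzFree X x₀) {ε : ℝ} (hε : 0 < ε) :
    ∃ (M : Set X) (T : ℕ → StrongDual ℝ (LipZero X x₀) →L[ℝ] StrongDual ℝ (LipZero X x₀))
      (T' : StrongDual ℝ (LipZero X x₀) → StrongDual ℝ (LipZero X x₀)),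
      IsCompact M ∧ x₀ ∈ M ∧ TendstoUniformlyOn (fun n μ => T n μ) T' atTop K ∧
      (∀ μ ∈ K, T' μ ∈ freeOn x₀ M) ∧ ∀ μ ∈ K, ‖T' μ - μ‖ ≤ ε := by
  have hδ2 : ∀ n : ℕ, 1 / ((n : ℝ) + 2) ≤ 1 / 2 := fun n => by
    apply one_div_le_one_div_of_le two_pos
    have : (0 : ℝ) ≤ n := n.cast_nonneg
    linarith
  have hδlim : Tendsto (fun n : ℕ => 1 / ((n : ℝ) + 2)) atTop (𝓝 0) := by
    have := (tendsto_const_div_atTop_nhds_zero_nat (1 : ℝ)).comp (tendsto_add_atTop_nat 2)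
    refine this.congr fun n => ?_
    simp
  -- The widths tend to `0` and start at `1/2`; the errors `ε / 2 / 2 ^ n` sum to `ε`.
  obtain ⟨E, A, T, hT0, hE, hxE, hEA, hA, hAE, hTs, happ⟩ :=
    exists_localization_seq hK hKX (δ := fun n => 1 / ((n : ℝ) + 2))
      (η := fun n => ε / 2 / 2 ^ n) (fun n => by positivity)
      (fun n => (hδ2 n).trans (by norm_num)) (fun n => by positivity)
  have hgeo : ∀ μ ∈ K, ∀ n, dist (T n μ) (T (n + 1) μ) ≤ ε / 2 / 2 ^ n := fun μ hμ n => by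
    rw [dist_comm, dist_eq_norm]
    exact hTs n μ hμ
  have hlim : ∀ μ ∈ K, ∃ ν, Tendsto (fun n => T n μ) atTop (𝓝 ν) := fun μ hμ =>
    cauchySeq_tendsto_of_complete (cauchySeq_of_le_geometric_two (hgeo μ hμ))
  choose! T' hT' using hlim
  have htwo : Tendsto (fun n : ℕ => ε / 2 ^ n) atTop (𝓝 0) := by
    have := (tendsto_pow_atTop_nhds_zero_of_lt_one (r := (1 / 2 : ℝ)) (by norm_num)
      (by norm_num)).const_mul ε
    rw [mul_zero] at this
    refine this.congr fun n => ?_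
    rw [one_div, inv_pow, div_eq_mul_inv]
  refine ⟨closure (⋃ n, E n), T, T', ?_, subset_closure (Set.mem_iUnion.2 ⟨0, hxE 0⟩), ?_,
    fun μ hμ => ?_, fun μ hμ => ?_⟩
  · exact (totallyBounded_iUnion_of_nested x₀ hE (fun n => ⟨x₀, hxE n⟩) (fun n => by positivity)
      hδ2 hδlim hEA hA hAE).closure.isCompact_of_isClosed isClosed_closure
  · rw [Metric.tendstoUniformlyOn_iff]
    intro r hr
    filter_upwards [htwo.eventually (gt_mem_nhds hr)] with n hn μ hμ
    rw [dist_comm]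
    exact (dist_le_of_le_geometric_two_of_tendsto (hgeo μ hμ) (hT' μ hμ) n).trans_lt hn
  -- `T n μ` itself is only known to be supported in `A n`; its approximants `ν n`, supported in `E
  -- n`, have the same limit.
  · choose ν hν hd using fun n => happ n μ hμ
    have hsub : Tendsto (fun n => T n μ - ν n) atTop (𝓝 0) := by
      refine squeeze_zero_norm (fun n => ?_) htwo
      refine (hd n).le.trans ?_
      gcongr
      linarith
    have hνlim : Tendsto ν atTop (𝓝 (T' μ)) := by
      simpa using (hT' μ hμ).sub hsub
    refine (isClosed_freeOn _).mem_of_tendsto hνlim (Eventually.of_forall fun n => ?_)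
    exact span_delta_le_freeOn _ (Submodule.span_mono (Set.image_mono
      ((Set.subset_iUnion E n).trans subset_closure)) (hν n))
  · have := dist_le_of_le_geometric_two_of_tendsto₀ (hgeo μ hμ) (hT' μ hμ)
    rwa [hT0, dist_comm, dist_eq_norm] at this

end LipZero

/-! ### Isometric embedding of the free space of a subset -/

namespace LipZero

variable {X : Type*} [MetricSpace X] {x₀ : X}

section Subspace

variable {B : Set X} (b₀ : B)

/-- Restriction to a subset, renormalized to vanish at its base point. -/
noncomputable def restrict (x₀ : X) (b₀ : B) : LipZero X x₀ →L[ℝ] LipZero B b₀ :=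
  LinearMap.mkContinuous
    { toFun := fun f => (⟨fun p => f p - f b₀,
        mem_lipSubmodule_of_abs_sub_le (norm_nonneg' f) (sub_self _) fun p q => by
          rw [sub_sub_sub_cancel_right]; exact abs_sub_le f p q⟩ : lipSubmodule B b₀)
      map_add' := fun f g => ext fun p => add_sub_add_comm (f p) (g p) (f b₀) (g b₀)
      map_smul' := fun c f => ext fun p => (mul_sub c (f p) (f b₀)).symm }
    1 fun f => norm_le_of_abs_sub_le (by rw [one_mul]; exact norm_nonneg' f) fun p q => by
      change |f p - f b₀ - (f q - f b₀)| ≤ _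
      rw [sub_sub_sub_cancel_right, one_mul]
      exact abs_sub_le f p q

theorem restrict_apply (f : LipZero X x₀) (p : B) : restrict x₀ b₀ f p = f p - f b₀ := rfl

theorem norm_restrict_le : ‖restrict x₀ b₀‖ ≤ 1 :=
  LinearMap.mkContinuous_norm_le _ zero_le_one _

/-- McShane extension with the same norm. -/
theorem exists_restrict_eq (g : LipZero B b₀) : ∃ f : LipZero X x₀, restrict x₀ b₀ f = g ∧
    ‖f‖ ≤ ‖g‖ := by
  classical
  have hg : LipschitzOnWith ‖g‖₊ (fun x : X => if h : x ∈ B then g ⟨x, h⟩ else 0) B := by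
    refine LipschitzOnWith.of_dist_le_mul fun x hx y hy => ?_
    rw [dif_pos hx, dif_pos hy, Real.dist_eq]
    exact abs_sub_le g ⟨x, hx⟩ ⟨y, hy⟩
  obtain ⟨f, hf, hfg⟩ := hg.extend_real
  have hfl : ∀ p q, |(f p - f x₀) - (f q - f x₀)| ≤ ‖g‖ * dist p q := fun p q => by
    rw [sub_sub_sub_cancel_right, ← Real.dist_eq]
    exact hf.dist_le_mul p q
  let F : LipZero X x₀ := (⟨fun p => f p - f x₀,
    mem_lipSubmodule_of_abs_sub_le (norm_nonneg g) (sub_self _) hfl⟩ : lipSubmodule X x₀)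
  refine ⟨F, ext fun p => ?_, norm_le_of_abs_sub_le (norm_nonneg g) hfl⟩
  have h : ∀ q : B, f q = g q := fun q => by
    rw [← hfg q.2]
    exact dif_pos q.2
  change (f p - f x₀) - (f b₀ - f x₀) = g p
  rw [sub_sub_sub_cancel_right, h, h, map_base, sub_zero]

/-- By McShane extension every function on `B` is a restriction of one with no larger norm, so no
norm is lost in dualizing. -/
theorem norm_dualOp_restrict (φ : StrongDual ℝ (LipZero B b₀)) :
    ‖dualOp (restrict x₀ b₀) φ‖ = ‖φ‖ := by
  refine le_antisymm ?_ (φ.opNorm_le_bound (norm_nonneg _) fun g => ?_)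
  · refine (norm_dualOp_apply_le _ _).trans ?_
    exact mul_le_of_le_one_left (norm_nonneg _) (norm_restrict_le b₀)
  · obtain ⟨f, rfl, hf⟩ := exists_restrict_eq (x₀ := x₀) b₀ g
    calc ‖φ (restrict x₀ b₀ f)‖ = ‖dualOp (restrict x₀ b₀) φ f‖ := rfl
      _ ≤ ‖dualOp (restrict x₀ b₀) φ‖ * ‖f‖ := ContinuousLinearMap.le_opNorm _ _
      _ ≤ _ := by gcongr

theorem dualOp_restrict_delta (p : B) :
    dualOp (restrict x₀ b₀) (delta b₀ p) = delta x₀ (p : X) - delta x₀ (b₀ : X) :=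
  ContinuousLinearMap.ext fun f => restrict_apply b₀ f p

theorem delta_base : delta x₀ x₀ = 0 := ContinuousLinearMap.ext fun f => map_base f

theorem delta_mem_lipschitzFree (p : X) : delta x₀ p ∈ LipschitzFree X x₀ :=
  Submodule.le_topologicalClosure _ (Submodule.subset_span ⟨p, rfl⟩)

theorem dualOp_restrict_mem {φ : StrongDual ℝ (LipZero B b₀)} (hφ : φ ∈ LipschitzFree B b₀) :
    dualOp (restrict x₀ b₀) φ ∈ LipschitzFree X x₀ := by
  rw [← freeOn_univ] at hφ
  refine map_mem_of_mem_freeOn (Submodule.isClosed_topologicalClosure _) _ (fun p _ => ?_) hφ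
  rw [dualOp_restrict_delta]
  exact Submodule.sub_mem _ (delta_mem_lipschitzFree _) (delta_mem_lipschitzFree _)

/-- The isometric embedding `ℱ(B) → ℱ(X)`. -/
noncomputable def inclusion (x₀ : X) (b₀ : B) : LipschitzFree B b₀ →ₗᵢ[ℝ] LipschitzFree X x₀ where
  toLinearMap := ((dualOp (restrict x₀ b₀)).toLinearMap.domRestrict _).codRestrict _
    fun φ => dualOp_restrict_mem b₀ φ.2
  norm_map' φ := norm_dualOp_restrict b₀ φ.1

instance completeSpace_lipschitzFree : CompleteSpace (LipschitzFree X x₀) :=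
  (Submodule.isClosed_topologicalClosure _).completeSpace_coe

/-- The embedding sends `δ_p` to `δ_p - δ_{b₀}`. As `x₀ ∈ B`, the difference of the images of `δ_p`
and `δ_{x₀}` is `δ_p`; the range is closed, so these generators suffice. -/
theorem exists_inclusion_eq (hx₀ : x₀ ∈ B) {μ : StrongDual ℝ (LipZero X x₀)}
    (hμ : μ ∈ freeOn x₀ B) :
    ∃ φ : LipschitzFree B b₀, (LipschitzFree X x₀).subtypeₗᵢ (inclusion x₀ b₀ φ) = μ := by
  let j := (LipschitzFree X x₀).subtypeₗᵢ.comp (inclusion x₀ b₀)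
  have hle : freeOn x₀ B ≤ LinearMap.range j.toLinearMap := by
    refine freeOn_le ?_ fun p hp => ?_
    · rw [LinearMap.coe_range]
      exact j.isometry.isClosedEmbedding.isClosed_range
    · refine ⟨⟨delta b₀ ⟨p, hp⟩ - delta b₀ ⟨x₀, hx₀⟩,
        Submodule.sub_mem _ (delta_mem_lipschitzFree _) (delta_mem_lipschitzFree _)⟩, ?_⟩
      change dualOp (restrict x₀ b₀) (delta b₀ ⟨p, hp⟩ - delta b₀ ⟨x₀, hx₀⟩) = _
      rw [map_sub, dualOp_restrict_delta, dualOp_restrict_delta, sub_sub_sub_cancel_right,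
        delta_base, sub_zero]
  exact hle hμ

end Subspace

end LipZero

/-- In a space that is locally modeled on an ideal of closed sets, compact sets are in the ideal. -/
theorem IsClosedIdeal.mem_of_isCompact {X : Type*} [MetricSpace X] {I : Set (Set X)}
    (hI : IsClosedIdeal I) (hloc : LocallyModeledOn I Set.univ) {M : Set X} (hM : IsCompact M) :
    M ∈ I := by
  have hsub : ∃ A ∈ I, M ⊆ A := by
    refine hM.induction_on (p := fun M => ∃ A ∈ I, M ⊆ A) ⟨∅, hI.empty_mem, subset_rfl⟩
      (fun s t hst ⟨A, hA, htA⟩ => ⟨A, hA, hst.trans htA⟩)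
      (fun s t ⟨A, hA, hsA⟩ ⟨B, hB, htB⟩ =>
        ⟨A ∪ B, hI.union_mem A hA B hB, Set.union_subset_union hsA htB⟩) fun x _ => ?_
    obtain ⟨θ, hθ, hball⟩ := hloc x (Set.mem_univ x)
    rw [Set.univ_inter] at hball
    exact ⟨_, mem_nhdsWithin_of_mem_nhds (Metric.closedBall_mem_nhds x hθ), _, hball, subset_rfl⟩
  obtain ⟨A, hA, hMA⟩ := hsub
  exact hI.mem_of_subset M A hM.isClosed hMA hA

theorem mainTheorem3 {X : Type*} [MetricSpace X] [CompleteSpace X] (x₀ : X)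
    (I : Set (Set X)) (hI : IsClosedIdeal I) (hloc : LocallyModeledOn I Set.univ)
    (hAP : ∀ A ∈ I, ∃ B : Set X, IsClosed B ∧ A ⊆ B ∧
      ∃ b₀ : B, HasApproximationProperty (LipschitzFree B b₀)) :
    HasApproximationProperty (LipschitzFree X x₀) := by
  refine hasApproximationProperty_of_uniform_limits (LipschitzFree X x₀).subtypeₗᵢ
    fun K hK hKX ε hε => ?_
  obtain ⟨M, T, T', hM, hxM, hT, hT'M, hT'⟩ := LipZero.exists_compact_reduction hK
    (fun μ hμ => by obtain ⟨ν, rfl⟩ := hKX hμ; exact ν.2) hε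
  obtain ⟨B, -, hMB, b₀, hB⟩ := hAP M (hI.mem_of_isCompact hloc hM)
  -- Uniform convergence makes `T'` continuous on `K`, hence `T' '' K` compact.
  have hcont : ContinuousOn T' K :=
    hT.continuousOn (Filter.Frequently.of_forall fun n => (T n).continuous.continuousOn)
  refine ⟨T, T', hT, hT', hB.exists_finiteRank_approx (LipZero.inclusion x₀ b₀) _
    (hK.image_of_continuousOn hcont) ?_ hε⟩
  rintro _ ⟨μ, hμ, rfl⟩
  exact LipZero.exists_inclusion_eq b₀ (hMB hxM) (LipZero.freeOn_mono hMB (hT'M μ hμ))
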